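/- Let $q,d\in\mathbb N$. Consider the random bipartite graph with agents $i=1,\dots,q$ and objects $j=1,\dots,d$ in which the edge indicators $\mathbb 1(i\sim j)$ are independent Bernoulli variables with $P(i\sim j)=p_{ij}$, and let $\deg(j)=\sum_{i=1}^q \mathbb 1(i\sim j)$. Let $V=(V_1,\dots,V_d)$ be a random vector with nonnegative, possibly dependent components, independent of the graph, such that for some $\alpha>0$ and $K_1,\dots,K_d>0$ $$P(V_j>t)\sim K_j t^{-\alpha},\qquad t\to\infty,\quad j=1,\dots,d .$$ Let $\pi_j=\prod_{i=1}^q(1-p_{ij})$, which is the probability that $\deg(j)=0$, and let $X_1,\dots,X_d$ be independent Poisson variables, jointly independent of $V$, where $X_j$ has mean $\pi_j$. Here $f(t)\sim g(t)$ means $f(t)/g(t)\to1$, and if $g$ is eventually $0$ it means that $f$ is eventually $0$. The vector $V$ is called asymptotically independent (respectively asymptotically fully dependent) if there is a nonzero Radon measure $\nu$ on $[0,\infty]^d\setminus\{0\}$ with $n\,P(n^{-1/\alpha}V\in\cdot)\to\nu$ vaguely as $n\to\infty$, and $\nu$ is concentrated on the union of the coordinate axes (respectively on the line $\{s\,(K_1^{1/\alpha},\dots,K_d^{1/\alpha})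 : 0<s<\infty\}$). Compact subsets of $[0,\infty]^d\setminus\{0\}$ are the compact subsets of $[0,\infty]^d$ not containing $0$. Then $$\sup_{t>0}\Big|P\Big(\sum_{j=1}^d \mathbb 1(\deg(j)=0)V_j\ge t\Big)-P\Big(\sum_{j=1}^d X_jV_j\ge t\Big)\Big|\le\sum_{j=1}^d\pi_j^2 .$$ If $V$ is asymptotically independent, then, as $t\to\infty$, $$P\Big(\sum_{j=1}^d X_jV_j\ge t\Big)\sim t^{-\alpha}\sum_{j=1}^d K_j\,\mathbb E X_j^\alpha ,$$ and if $V$ is asymptotically fully dependent, then, as $t\to\infty$, $$P\Big(\sum_{j=1}^d X_jV_j\ge t\Big)\sim t^{-\alpha}\,\mathbb E\Big(\sum_{j=1}^d K_j^{1/\alpha}X_j\Big)^{\alpha},$$ where the expectations on the right-hand sides are finite. -/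

import Mathlib

open MeasureTheory ProbabilityTheory Filter Topology Asymptotics
open scoped ENNReal NNReal

noncomputable section

namespace InsuranceMarket

/-- The punctured orthant `[0,∞]^d ∖ {0}`. With the subspace topology (of the product topology on
`[0,∞]^d`), its compact sets are exactly the compact subsets of `[0,∞]^d` that do not contain `0`
(the one-point uncompactification). -/
abbrev PuncturedOrthant (d : ℕ) : Type := {x : Fin d → ℝ≥0∞ // x ≠ 0}

/-- Vague convergence of a sequence of measures: convergence of the integrals of all continuous
functions with compact support. -/
def VagueTendsto {E : Type*} [TopologicalSpace E] [MeasurableSpace E]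
    (m : ℕ → Measure E) (ν : Measure E) : Prop :=
  ∀ f : E → ℝ, Continuous f → HasCompactSupport f →
    Tendsto (fun n => ∫ x, f x ∂(m n)) atTop (𝓝 (∫ x, f x ∂ν))

/-- For a random vector `V` with nonnegative components and a number `b > 0`, the measure
`S ↦ P (V / b ∈ S)` on Borel subsets `S` of `[0,∞]^d ∖ {0}`. -/
def scaledLaw {Ω : Type*} [MeasurableSpace Ω] (P : Measure Ω) {d : ℕ}
    (V : Fin d → Ω → ℝ) (b : ℝ) : Measure (PuncturedOrthant d) :=
  (P.map (fun ω j => ENNReal.ofReal (V j ω / b))).comap Subtype.val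

/-- `ν` is the exponent measure of the nonnegative random vector `V` for the normalizing sequence
`b`: it is a nonzero Radon measure on `[0,∞]^d ∖ {0}` (locally finite is the same as Radon on this
space, which is locally compact and second countable), and `n P (V / b n ∈ ·) → ν` vaguely. -/
structure IsExponentMeasure {Ω : Type*} [MeasurableSpace Ω] (P : Measure Ω) {d : ℕ}
    (V : Fin d → Ω → ℝ) (b : ℕ → ℝ) (ν : Measure (PuncturedOrthant d)) : Prop where
  finite_on_compacts : IsFiniteMeasureOnCompacts ν
  ne_zero : ν ≠ 0
  tendsto : VagueTendsto (fun n : ℕ => (n : ℝ≥0∞) • scaledLaw P V (b n)) ν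

/-- The union of the coordinate axes in `[0,∞]^d ∖ {0}`. -/
def axes (d : ℕ) : Set (PuncturedOrthant d) :=
  {x | ∃ j, ∀ k, k ≠ j → x.1 k = 0}

/-- The open half-line `{s K^{1/α} 1 : 0 < s < ∞}` in `[0,∞]^d ∖ {0}`. -/
def dependenceLine {d : ℕ} (α : ℝ) (K : Fin d → ℝ) : Set (PuncturedOrthant d) :=
  {x | ∃ s : ℝ, 0 < s ∧ ∀ j, x.1 j = ENNReal.ofReal (s * K j ^ (1 / α))}

/-- The nonnegative vector `V` is multivariate regularly varying, with exponent measure (for the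
normalization `b n = n^{1/α}`) having mass only on the axes. -/
def AsymptoticallyIndependent {Ω : Type*} [MeasurableSpace Ω] (P : Measure Ω) {d : ℕ}
    (V : Fin d → Ω → ℝ) (α : ℝ) : Prop :=
  ∃ ν : Measure (PuncturedOrthant d),
    IsExponentMeasure P V (fun n => (n : ℝ) ^ (1 / α)) ν ∧ ν (axes d)ᶜ = 0

/-- The nonnegative vector `V` is multivariate regularly varying, with exponent measure (for the
normalization `b n = n^{1/α}`) having mass only on the line `{s K^{1/α} 1 : s > 0}`. -/
def AsymptoticallyFullyDependent {Ω : Type*} [MeasurableSpace Ω] (P : Measure Ω) {d : ℕ}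
    (V : Fin d → Ω → ℝ) (α : ℝ) (K : Fin d → ℝ) : Prop :=
  ∃ ν : Measure (PuncturedOrthant d),
    IsExponentMeasure P V (fun n => (n : ℝ) ^ (1 / α)) ν ∧ ν (dependenceLine α K)ᶜ = 0

/-- The number of agents insuring object `j` in the random bipartite graph in which agent `i` and
object `j` are linked in the outcome `ω` when `edge i j ω = true`. -/
def deg {Ω : Type*} {q d : ℕ} (edge : Fin q → Fin d → Ω → Bool) (j : Fin d) (ω : Ω) : ℕ :=
  (Finset.univ.filter (fun i => edge i j ω = true)).card

/-- The total uninsured loss `∑_j 1(deg(j) = 0) V_j`. -/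
def uninsuredLoss {Ω : Type*} {q d : ℕ} (edge : Fin q → Fin d → Ω → Bool)
    (V : Fin d → Ω → ℝ) (ω : Ω) : ℝ :=
  ∑ j, if deg edge j ω = 0 then V j ω else 0

/-- `π_j = ∏_i (1 - p_ij)`. -/
def uninsuredProb {q d : ℕ} (p : Fin q → Fin d → ℝ) (j : Fin d) : ℝ :=
  ∏ i, (1 - p i j)

end InsuranceMarket

end

/-!
Both parts of the theorem are obtained by conditioning.

For the total variation bound, condition on the claims `V`: it suffices to compare the laws of the
isolation indicators `1(deg j = 0)` and of the Poisson vector `X`. Both have independent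
coordinates (distinct objects use disjoint sets of edges, `iIndepFun_isolated`), total variation is
subadditive over products (`abs_pi_sub_pi_le`), and a Bernoulli law of mean `p` is within `p ^ 2` of
the Poisson law of the same mean (`abs_bernoulli_sub_poisson_le`).

For the tail asymptotics, condition on `X` instead. For fixed coefficients `x` the scaled tail
`t ^ α * P (∑ x j * V j ≥ t)` has a limit, and it is bounded, uniformly in `t`, by a combination of
the `x j ^ α` (`exists_tail_sum_bound`), which is integrable under the Poisson law; dominated
convergence then gives the tail with random coefficients (`tail_randomCoefficients`).

The limits for fixed coefficients use the exponent measure only through negligible events: a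
compactly supported continuous function that vanishes on the support of the exponent measure
provides an event of probability `o (1 / n)` (`tendsto_mul_measureReal_testFunction`).
* If the exponent measure lives on the axes, two components are not large together, so the tail of
  the sum is the sum of the tails (`tendsto_tail_sum_of_pairwise`).
* If it lives on the line spanned by `K j ^ (1 / α)`, all components divided by `K j ^ (1 / α)` are
  asymptotically equal when one of them is large, so the sum behaves as a multiple of a single
  component (`tendsto_tail_sum_of_asymptoticallyFullyDependent`).
-/

namespace InsuranceMarket

/-! ### Total variation and product measures -/

section TotalVariation

variable {α β : Type*} [MeasurableSpace α] [MeasurableSpace β]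

lemma measureReal_prod_apply (μ : Measure α) (ν : Measure β) [IsFiniteMeasure μ]
    [IsFiniteMeasure ν] {s : Set (α × β)} (hs : MeasurableSet s) :
    (μ.prod ν).real s = ∫ x, ν.real (Prod.mk x ⁻¹' s) ∂μ := by
  rw [measureReal_def, Measure.prod_apply hs]
  exact (integral_toReal (measurable_measure_prodMk_left hs).aemeasurable
    (ae_of_all _ fun x => measure_lt_top _ _)).symm

lemma abs_prod_sub_prod_right_le (μ : Measure α) [IsProbabilityMeasure μ] (ν ν' : Measure β)
    [IsFiniteMeasure ν] [IsFiniteMeasure ν'] {ε : ℝ}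
    (h : ∀ s, MeasurableSet s → |ν.real s - ν'.real s| ≤ ε)
    {s : Set (α × β)} (hs : MeasurableSet s) :
    |(μ.prod ν).real s - (μ.prod ν').real s| ≤ ε := by
  rw [measureReal_prod_apply μ ν hs, measureReal_prod_apply μ ν' hs,
    ← integral_sub (Measure.integrable_measure_prodMk_left hs (measure_ne_top _ _))
      (Measure.integrable_measure_prodMk_left hs (measure_ne_top _ _))]
  simpa using norm_integral_le_of_norm_le_const (μ := μ) (C := ε)
    (f := fun x => ν.real (Prod.mk x ⁻¹' s) - ν'.real (Prod.mk x ⁻¹' s))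
    (ae_of_all _ fun x => h _ (measurable_prodMk_left hs))

lemma abs_prod_sub_prod_left_le (μ : Measure α) [IsProbabilityMeasure μ] (ν ν' : Measure β)
    [IsFiniteMeasure ν] [IsFiniteMeasure ν'] {ε : ℝ}
    (h : ∀ s, MeasurableSet s → |ν.real s - ν'.real s| ≤ ε)
    {s : Set (β × α)} (hs : MeasurableSet s) :
    |(ν.prod μ).real s - (ν'.prod μ).real s| ≤ ε := by
  rw [← Measure.prod_swap (μ := μ) (ν := ν), ← Measure.prod_swap (μ := μ) (ν := ν'),
    map_measureReal_apply measurable_swap hs, map_measureReal_apply measurable_swap hs]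
  exact abs_prod_sub_prod_right_le μ ν ν' h (measurable_swap hs)

/-- Total variation distance is subadditive over finite products: the factors are exchanged one
at a time. -/
theorem abs_pi_sub_pi_le {n : ℕ} (μ ν : Fin n → Measure α) [∀ i, IsProbabilityMeasure (μ i)]
    [∀ i, IsProbabilityMeasure (ν i)] (ε : Fin n → ℝ)
    (h : ∀ i s, MeasurableSet s → |(μ i).real s - (ν i).real s| ≤ ε i)
    {s : Set (Fin n → α)} (hs : MeasurableSet s) :
    |(Measure.pi μ).real s - (Measure.pi ν).real s| ≤ ∑ i, ε i := by
  induction n with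
  | zero => simp [Measure.pi_of_empty μ, Measure.pi_of_empty ν]
  | succ n ih =>
    have key : ∀ (m : Fin (n + 1) → Measure α) [∀ i, IsProbabilityMeasure (m i)],
        (Measure.pi m).real s = ((m 0).prod (Measure.pi fun j => m (Fin.succAbove 0 j))).real
          ((MeasurableEquiv.piFinSuccAbove (fun _ => α) 0).symm ⁻¹' s) := by
      intro m _
      rw [← (measurePreserving_piFinSuccAbove m 0).map_eq,
        map_measureReal_apply (MeasurableEquiv.measurable _) ((MeasurableEquiv.measurable _) hs),
        ← Set.preimage_comp]
      simp
    rw [key μ, key ν, Fin.sum_univ_succ]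
    have hs' := (MeasurableEquiv.piFinSuccAbove (fun _ : Fin (n + 1) => α) 0).symm.measurable hs
    have h1 := abs_prod_sub_prod_left_le (Measure.pi fun j => μ (Fin.succAbove 0 j)) (μ 0) (ν 0)
      (h 0) hs'
    have h2 := abs_prod_sub_prod_right_le (ν 0) (Measure.pi fun j => μ (Fin.succAbove 0 j))
      (Measure.pi fun j => ν (Fin.succAbove 0 j))
      (fun s hs => ih (fun j => μ (Fin.succAbove 0 j)) (fun j => ν (Fin.succAbove 0 j))
        (fun j => ε j.succ) (fun i s hs => h i.succ s hs) hs) hs'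
    exact (abs_sub_le _ _ _).trans (add_le_add h1 h2)

end TotalVariation

/-! ### Poisson approximation of a Bernoulli variable -/

/-- Away from the point `1` the Poisson measure dominates the Bernoulli measure of the same mean,
since `1 - p ≤ exp (-p)`. -/
lemma bernoulli_le_poisson_of_notMem {p : ℝ≥0} (μ : Measure ℕ) [IsProbabilityMeasure μ]
    (h0 : μ.real {0} = 1 - p) (h1 : μ.real {1} = p) {s : Set ℕ} (hs : 1 ∉ s) :
    μ.real s ≤ (poissonMeasure p).real s := by
  have h01 : μ.real ({0, 1}ᶜ : Set ℕ) = 0 := by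
    rw [measureReal_compl (by measurability), probReal_univ, Set.insert_eq,
      measureReal_union (by simp) (by measurability), h0, h1]
    ring
  by_cases hz : 0 ∈ s
  · calc μ.real s ≤ μ.real ({0} ∪ ({0, 1}ᶜ : Set ℕ)) := by
          refine measureReal_mono fun x hx => ?_
          have : x ≠ 1 := fun h => hs (h ▸ hx)
          by_cases hx0 : x = 0 <;> simp [hx0, this]
      _ ≤ 1 - p := (measureReal_union_le _ _).trans (by rw [h01, h0, add_zero])
      _ ≤ Real.exp (-p) := by linarith [Real.add_one_le_exp (-(p : ℝ))]
      _ = (poissonMeasure p).real {0} := by simp [poissonMeasure_real_singleton]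
      _ ≤ _ := measureReal_mono (by simpa using hz)
  · calc μ.real s ≤ μ.real ({0, 1}ᶜ : Set ℕ) := by
          refine measureReal_mono fun x hx => ?_
          have : x ≠ 1 := fun h => hs (h ▸ hx)
          have : x ≠ 0 := fun h => hz (h ▸ hx)
          simp [*]
      _ ≤ _ := by rw [h01]; exact measureReal_nonneg

lemma abs_bernoulli_sub_poisson_le_of_notMem {p : ℝ≥0} (μ : Measure ℕ) [IsProbabilityMeasure μ]
    (h0 : μ.real {0} = 1 - p) (h1 : μ.real {1} = p) {s : Set ℕ} (hs : 1 ∉ s) :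
    |μ.real s - (poissonMeasure p).real s| ≤ (p : ℝ) ^ 2 := by
  have hle := bernoulli_le_poisson_of_notMem μ h0 h1 hs
  have hle' := bernoulli_le_poisson_of_notMem μ h0 h1 (s := {1}ᶜ \ s) (by simp)
  have hss : s ⊆ ({1}ᶜ : Set ℕ) := by simpa using hs
  rw [measureReal_sdiff hss .of_discrete, measureReal_sdiff hss .of_discrete,
    measureReal_compl .of_discrete, measureReal_compl .of_discrete, h1,
    poissonMeasure_real_singleton] at hle'
  simp only [probReal_univ, pow_one, Nat.factorial_one, Nat.cast_one, div_one] at hle'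
  rw [abs_le]
  have := mul_le_mul_of_nonneg_right (Real.add_one_le_exp (-(p : ℝ))) p.coe_nonneg
  constructor <;> nlinarith [sq_nonneg (p : ℝ)]

/-- The total variation distance between the Bernoulli and the Poisson law of mean `p` is at most
`p ^ 2`; it suffices to treat events missing the point `1`, passing to complements otherwise. -/
theorem abs_bernoulli_sub_poisson_le {p : ℝ≥0} (μ : Measure ℕ) [IsProbabilityMeasure μ]
    (h0 : μ.real {0} = 1 - p) (h1 : μ.real {1} = p) (s : Set ℕ) :
    |μ.real s - (poissonMeasure p).real s| ≤ (p : ℝ) ^ 2 := by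
  by_cases hs : 1 ∈ s
  · have := abs_bernoulli_sub_poisson_le_of_notMem μ h0 h1 (s := sᶜ) (by simpa using hs)
    rw [measureReal_compl .of_discrete, measureReal_compl .of_discrete, abs_sub_comm] at this
    simpa using this
  · exact abs_bernoulli_sub_poisson_le_of_notMem μ h0 h1 hs

/-! ### Isolated objects of the random bipartite graph -/

section Graph

variable {Ω : Type*} {q d : ℕ}

/-- The indicator that object `j` has degree zero. -/
def isolated (edge : Fin q → Fin d → Ω → Bool) (j : Fin d) (ω : Ω) : ℕ :=
  if deg edge j ω = 0 then 1 else 0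

lemma isolated_eq_comp (edge : Fin q → Fin d → Ω → Bool) (j : Fin d) :
    isolated edge j = (fun e : Fin q → Bool =>
      if (Finset.univ.filter fun i => e i = true).card = 0 then 1 else 0) ∘
        fun ω i => edge i j ω := rfl

lemma isolated_preimage_one (edge : Fin q → Fin d → Ω → Bool) (j : Fin d) :
    isolated edge j ⁻¹' {1} = {ω | deg edge j ω = 0} := by
  ext ω; simp [isolated]

lemma isolated_preimage_zero (edge : Fin q → Fin d → Ω → Bool) (j : Fin d) :
    isolated edge j ⁻¹' {0} = (isolated edge j ⁻¹' {1})ᶜ := by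
  ext ω; simp [isolated]

lemma uninsuredLoss_eq (edge : Fin q → Fin d → Ω → Bool) (V : Fin d → Ω → ℝ) (ω : Ω) :
    uninsuredLoss edge V ω = ∑ j, (isolated edge j ω : ℝ) * V j ω := by
  simp [uninsuredLoss, isolated]

variable [MeasurableSpace Ω] {P : Measure Ω} [IsProbabilityMeasure P]


/-- Blocks of an independent doubly indexed family are independent. -/
theorem iIndepFun_curry {ι κ β : Type*} [Finite ι] [Finite κ] [MeasurableSpace β]
    {f : ι → κ → Ω → β} (hm : ∀ i j, Measurable (f i j))
    (h : iIndepFun (fun e : ι × κ => f e.1 e.2) P) :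
    iIndepFun (fun i ω j => f i j ω) P := by
  have : ∀ i j, IsProbabilityMeasure (P.map (f i j)) :=
    fun i j => Measure.isProbabilityMeasure_map (hm i j).aemeasurable
  rw [iIndepFun_iff_map_fun_eq_infinitePi_map fun i => measurable_pi_lambda _ (hm i)]
  have h1 := (iIndepFun_iff_map_fun_eq_infinitePi_map fun e : ι × κ => hm e.1 e.2).1 h
  have h2 : ∀ i, P.map (fun ω j => f i j ω) = Measure.infinitePi fun j => P.map (f i j) :=
    fun i => (iIndepFun_iff_map_fun_eq_infinitePi_map (hm i)).1
      (h.precomp (g := fun j : κ => (i, j)) (Prod.mk_right_injective i))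
  simp_rw [h2]
  rw [← Measure.infinitePi_map_curry, ← h1,
    Measure.map_map (MeasurableEquiv.measurable _) (by fun_prop)]
  rfl

variable {edge : Fin q → Fin d → Ω → Bool} {p : Fin q → Fin d → ℝ}

lemma measurable_isolated (hm : ∀ i j, Measurable (edge i j)) (j : Fin d) :
    Measurable (isolated edge j) := by
  rw [isolated_eq_comp]
  exact Measurable.of_discrete.comp (measurable_pi_lambda _ fun i => hm i j)

lemma iIndepFun_isolated (hm : ∀ i j, Measurable (edge i j))
    (h : iIndepFun (fun e : Fin q × Fin d => edge e.1 e.2) P) :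
    iIndepFun (isolated edge) P := by
  have h' : iIndepFun (fun j ω i => edge i j ω) P :=
    iIndepFun_curry (f := fun j i => edge i j) (fun j i => hm i j)
      (h.precomp (g := Prod.swap) Prod.swap_injective)
  simp_rw [funext (isolated_eq_comp edge)]
  exact h'.comp _ fun _ => Measurable.of_discrete

lemma measureReal_deg_eq_zero (hm : ∀ i j, Measurable (edge i j))
    (h : iIndepFun (fun e : Fin q × Fin d => edge e.1 e.2) P)
    (hp : ∀ i j, P.real {ω | edge i j ω = true} = p i j) (j : Fin d) :
    P.real {ω | deg edge j ω = 0} = uninsuredProb p j := by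
  have hj := (h.precomp (g := fun i : Fin q => (i, j))
    (Prod.mk_left_injective j)).measure_inter_preimage_eq_mul Finset.univ
    (sets := fun _ => {false}) fun _ _ => .of_discrete
  have hset : {ω | deg edge j ω = 0} = ⋂ i ∈ Finset.univ, edge i j ⁻¹' {false} := by
    ext ω
    simp [deg, Finset.filter_eq_empty_iff]
  rw [hset, measureReal_def, hj, ENNReal.toReal_prod]
  refine Finset.prod_congr rfl fun i _ => ?_
  have : edge i j ⁻¹' {false} = {ω | edge i j ω = true}ᶜ := by ext ω; simp
  have hmt : MeasurableSet {ω | edge i j ω = true} := hm i j (measurableSet_singleton true)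
  change P.real (edge i j ⁻¹' {false}) = _
  rw [this, measureReal_compl hmt, hp, probReal_univ]

lemma measurableSet_sum_mul {d : ℕ} (t : ℝ) :
    MeasurableSet {z : (Fin d → ℕ) × (Fin d → ℝ) | t ≤ ∑ j, (z.1 j : ℝ) * z.2 j} := by
  have hc : Measurable (Nat.cast : ℕ → ℝ) := Measurable.of_discrete
  exact measurableSet_le measurable_const (Finset.measurable_sum _ fun j _ =>
    (hc.comp ((measurable_pi_apply j).comp measurable_fst)).mul
      ((measurable_pi_apply j).comp measurable_snd))

/-- A probability about a linear combination with independent weights, under the product of the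
law of the weights and the law of the vector. -/
lemma map_prod_measureReal_sum_mul {Y : Fin d → Ω → ℕ} {V : Fin d → Ω → ℝ}
    (hY : ∀ j, Measurable (Y j)) (hV : ∀ j, Measurable (V j))
    (hYV : IndepFun (fun ω j => Y j ω) (fun ω j => V j ω) P) (t : ℝ) :
    P.real {ω | t ≤ ∑ j, (Y j ω : ℝ) * V j ω} =
      ((P.map fun ω j => Y j ω).prod (P.map fun ω j => V j ω)).real
        {z | t ≤ ∑ j, (z.1 j : ℝ) * z.2 j} := by
  have hY' : Measurable fun ω j => Y j ω := measurable_pi_lambda _ hY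
  have hV' : Measurable fun ω j => V j ω := measurable_pi_lambda _ hV
  rw [← (indepFun_iff_map_prod_eq_prod_map_map hY'.aemeasurable hV'.aemeasurable).1 hYV,
    map_measureReal_apply (hY'.prodMk hV') (measurableSet_sum_mul t)]
  rfl

/-- Replacing the isolation indicators by Poisson variables of the same means changes the law of
the total loss by at most `∑ j, π_j ^ 2` in total variation. -/
theorem abs_uninsuredLoss_sub_poisson_le (hm : ∀ i j, Measurable (edge i j))
    (h : iIndepFun (fun e : Fin q × Fin d => edge e.1 e.2) P)
    (hp : ∀ i j, P.real {ω | edge i j ω = true} = p i j)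
    {V : Fin d → Ω → ℝ} (hV : ∀ j, Measurable (V j))
    (hVG : IndepFun (fun ω j => V j ω) (fun ω i j => edge i j ω) P)
    {X : Fin d → Ω → ℕ} (hX : ∀ j, Measurable (X j)) (hXi : iIndepFun X P)
    (hXl : ∀ j, HasLaw (X j) (poissonMeasure (uninsuredProb p j).toNNReal) P)
    (hXV : IndepFun (fun ω j => X j ω) (fun ω j => V j ω) P) (t : ℝ) :
    |P.real {ω | t ≤ uninsuredLoss edge V ω} -
        P.real {ω | t ≤ ∑ j, (X j ω : ℝ) * V j ω}| ≤ ∑ j, uninsuredProb p j ^ 2 := by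
  have hIV : IndepFun (fun ω j => isolated edge j ω) (fun ω j => V j ω) P := by
    let φ : (Fin q → Fin d → Bool) → Fin d → ℕ := fun e j =>
      if (Finset.univ.filter fun i => e i j = true).card = 0 then 1 else 0
    have hφ : Measurable φ := Measurable.of_discrete
    exact hVG.symm.comp hφ measurable_id
  have hI := measurable_isolated hm
  have : IsProbabilityMeasure (P.map fun ω j => V j ω) :=
    Measure.isProbabilityMeasure_map (measurable_pi_lambda _ hV).aemeasurable
  have : ∀ j, IsProbabilityMeasure (P.map (X j)) :=
    fun j => Measure.isProbabilityMeasure_map (hX j).aemeasurable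
  have : ∀ j, IsProbabilityMeasure (P.map (isolated edge j)) :=
    fun j => Measure.isProbabilityMeasure_map (hI j).aemeasurable
  simp_rw [uninsuredLoss_eq]
  rw [map_prod_measureReal_sum_mul hI hV hIV, map_prod_measureReal_sum_mul hX hV hXV,
    (iIndepFun_iff_map_fun_eq_pi_map fun j => (hX j).aemeasurable).1 hXi,
    (iIndepFun_iff_map_fun_eq_pi_map fun j => (hI j).aemeasurable).1 (iIndepFun_isolated hm h)]
  refine abs_prod_sub_prod_left_le _ _ _ (fun s hs => ?_) (measurableSet_sum_mul t)
  refine abs_pi_sub_pi_le _ _ _ (fun j s _ => ?_) hs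
  have hdeg := measureReal_deg_eq_zero hm h hp j
  have hnn : 0 ≤ uninsuredProb p j := hdeg ▸ measureReal_nonneg
  have h1 : P.real (isolated edge j ⁻¹' {1}) = uninsuredProb p j := by
    rw [isolated_preimage_one, hdeg]
  rw [(hXl j).map_eq]
  simpa [Real.coe_toNNReal _ hnn] using
    abs_bernoulli_sub_poisson_le (p := (uninsuredProb p j).toNNReal) (P.map (isolated edge j))
    (by rw [map_measureReal_apply (hI j) .of_discrete, isolated_preimage_zero,
          measureReal_compl (hI j .of_discrete), h1, probReal_univ, Real.coe_toNNReal _ hnn])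
    (by rw [map_measureReal_apply (hI j) .of_discrete, h1, Real.coe_toNNReal _ hnn]) s

end Graph

/-! ### Limits obtained from one-parameter families of bounds -/

/-- Sandwich principle with bounds depending on a parameter `δ` that is sent to `0` after the
variable has been sent to infinity. -/
lemma tendsto_of_parametric_bounds {g L U : ℝ → ℝ} {ℓ : ℝ} (lo hi : ℝ → ℝ → ℝ)
    (hL : Tendsto L (𝓝[>] 0) (𝓝 ℓ)) (hU : Tendsto U (𝓝[>] 0) (𝓝 ℓ))
    (h : ∀ δ ∈ Set.Ioo (0 : ℝ) 1, (∀ᶠ t in atTop, lo δ t ≤ g t ∧ g t ≤ hi δ t) ∧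
      Tendsto (lo δ) atTop (𝓝 (L δ)) ∧ Tendsto (hi δ) atTop (𝓝 (U δ))) :
    Tendsto g atTop (𝓝 ℓ) := by
  have hI : ∀ᶠ δ in 𝓝[>] (0 : ℝ), δ ∈ Set.Ioo (0 : ℝ) 1 := Ioo_mem_nhdsGT one_pos
  refine tendsto_order.2 ⟨fun a ha => ?_, fun a ha => ?_⟩
  · obtain ⟨δ, hδ, hδI⟩ := ((hL.eventually (lt_mem_nhds ha)).and hI).exists
    obtain ⟨h1, h2, -⟩ := h δ hδI
    filter_upwards [h1, h2.eventually (lt_mem_nhds hδ)] with t h3 h4 using h4.trans_le h3.1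
  · obtain ⟨δ, hδ, hδI⟩ := ((hU.eventually (gt_mem_nhds ha)).and hI).exists
    obtain ⟨h1, -, h2⟩ := h δ hδI
    filter_upwards [h1, h2.eventually (gt_mem_nhds hδ)] with t h3 h4 using h3.2.trans_lt h4

lemma tendsto_const_mul_one_sub_rpow (c β : ℝ) :
    Tendsto (fun δ : ℝ => c * (1 - δ) ^ β) (𝓝[>] 0) (𝓝 c) := by
  have h : ContinuousAt (fun δ : ℝ => c * (1 - δ) ^ β) 0 := by
    refine continuousAt_const.mul (ContinuousAt.rpow_const (by fun_prop) (Or.inl (by norm_num)))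
  simpa using h.tendsto.mono_left nhdsWithin_le_nhds

section Tails

variable {Ω : Type*} [MeasurableSpace Ω] {P : Measure Ω} [IsProbabilityMeasure P] {α : ℝ}

/-! ### Tails of a single variable -/

lemma tendsto_rpow_mul_of_isEquivalent {f : ℝ → ℝ} {κ : ℝ} (hκ : 0 < κ)
    (h : f ~[atTop] fun t => κ * t ^ (-α)) :
    Tendsto (fun t => t ^ α * f t) atTop (𝓝 κ) := by
  have hne : ∀ᶠ t : ℝ in atTop, κ * t ^ (-α) ≠ 0 := by
    filter_upwards [eventually_gt_atTop 0] with t ht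
    positivity
  have h1 := ((isEquivalent_iff_tendsto_one hne).1 h).const_mul κ
  rw [mul_one] at h1
  refine h1.congr' ?_
  filter_upwards [eventually_gt_atTop 0] with t ht
  have := (Real.rpow_pos_of_pos ht α).ne'
  rw [Pi.div_apply, Real.rpow_neg ht.le]
  field_simp

/-- A limit at infinity for functions scaled by `t ^ α` is preserved, up to the factor `u ^ (-α)`,
by the change of scale `t ↦ u * t`. -/
lemma tendsto_rpow_mul_comp_mul {f : ℝ → ℝ} {κ u : ℝ} (hu : 0 < u)
    (h : Tendsto (fun t => t ^ α * f t) atTop (𝓝 κ)) :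
    Tendsto (fun t => t ^ α * f (u * t)) atTop (𝓝 (κ * u ^ (-α))) := by
  have h1 := (h.comp (tendsto_id.const_mul_atTop hu)).mul_const (u ^ (-α))
  refine h1.congr' ?_
  filter_upwards [eventually_gt_atTop 0] with t ht
  have := (Real.rpow_pos_of_pos hu α).ne'
  simp only [Function.comp_apply, id]
  rw [Real.mul_rpow hu.le ht.le, Real.rpow_neg hu.le]
  field_simp

variable {W : Ω → ℝ} {κ : ℝ}

/-- The tail asymptotics hold with a weak inequality as well as with a strict one, and for any
nonnegative multiple of the variable. -/
theorem tendsto_tail_mul (hα : 0 < α) (hκ : 0 < κ)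
    (h : (fun t : ℝ => P.real {ω | t < W ω}) ~[atTop] fun t => κ * t ^ (-α))
    {x u : ℝ} (hx : 0 ≤ x) (hu : 0 < u) :
    Tendsto (fun t : ℝ => t ^ α * P.real {ω | u * t ≤ x * W ω}) atTop
      (𝓝 (κ * x ^ α * u ^ (-α))) := by
  have h0 := tendsto_rpow_mul_of_isEquivalent hκ h
  have h1 : Tendsto (fun t : ℝ => t ^ α * P.real {ω | t ≤ W ω}) atTop (𝓝 κ) := by
    refine tendsto_of_parametric_bounds (fun _ t => t ^ α * P.real {ω | t < W ω})
      (fun δ t => t ^ α * P.real {ω | (1 - δ) * t < W ω}) tendsto_const_nhds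
      (tendsto_const_mul_one_sub_rpow κ (-α)) fun δ hδ => ⟨?_, h0, ?_⟩
    · filter_upwards [eventually_gt_atTop 0] with t ht
      refine ⟨?_, ?_⟩
      · refine mul_le_mul_of_nonneg_left (measureReal_mono fun ω hω => ?_) (by positivity)
        exact le_of_lt (α := ℝ) hω
      · refine mul_le_mul_of_nonneg_left (measureReal_mono ?_) (by positivity)
        intro ω (hω : t ≤ W ω)
        have := mul_pos hδ.1 ht
        change (1 - δ) * t < W ω
        linarith
    · exact tendsto_rpow_mul_comp_mul (f := fun t => P.real {ω | t < W ω})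
        (by linarith [hδ.2]) h0
  rcases hx.eq_or_lt with rfl | hx
  · rw [Real.zero_rpow hα.ne', mul_zero, zero_mul]
    refine tendsto_const_nhds.congr' ?_
    filter_upwards [eventually_gt_atTop 0] with t ht
    have : ¬ u * t ≤ 0 := not_le.2 (mul_pos hu ht)
    simp [this]
  · have := tendsto_rpow_mul_comp_mul (f := fun t => P.real {ω | t ≤ W ω}) (div_pos hu hx) h1
    convert! this using 1
    · ext t
      congr 3
      ext ω
      rw [div_mul_eq_mul_div, div_le_iff₀ hx, mul_comm x]
    · rw [Real.div_rpow hu.le hx.le, Real.rpow_neg hx.le, div_inv_eq_mul]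
      ring_nf

/-! ### Negligible events from vague convergence -/

variable {d : ℕ} {V : Fin d → Ω → ℝ}

/-- If the test function `x ↦ φ (x i) * ψ (x j)` vanishes almost everywhere for the exponent
measure, then the event that it is at least `1` at `V / b n` has probability `o (1 / n)`. That `φ`
vanishes near `0` makes the support of the test function compact. -/
theorem tendsto_mul_measureReal_testFunction {b : ℕ → ℝ} {ν : Measure (PuncturedOrthant d)}
    (hν : IsExponentMeasure P V b ν) (hV : ∀ j, Measurable (V j)) {φ ψ : ℝ≥0∞ → ℝ}
    (hφ : Continuous φ) (hψ : Continuous ψ) (hφ0 : ∀ x, 0 ≤ φ x) (hψ0 : ∀ x, 0 ≤ ψ x)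
    {a : ℝ≥0∞} (ha : a ≠ 0) (hφa : ∀ x ≤ a, φ x = 0) (i j : Fin d)
    (h : ∀ᵐ x ∂ν, φ (x.1 i) * ψ (x.1 j) = 0) :
    Tendsto (fun n : ℕ => (n : ℝ) * P.real {ω | 1 ≤ φ (ENNReal.ofReal (V i ω / b n)) *
      ψ (ENNReal.ofReal (V j ω / b n))}) atTop (𝓝 0) := by
  set f : PuncturedOrthant d → ℝ := fun x => φ (x.1 i) * ψ (x.1 j) with hf
  have hfc : Continuous f := (hφ.comp ((continuous_apply i).comp continuous_subtype_val)).mul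
    (hψ.comp ((continuous_apply j).comp continuous_subtype_val))
  have hf0 : ∀ x, 0 ≤ f x := fun x => mul_nonneg (hφ0 _) (hψ0 _)
  have hfs : HasCompactSupport f := by
    refine HasCompactSupport.intro (K := {x | a ≤ x.1 i}) ?_ fun x hx => ?_
    · rw [Subtype.isCompact_iff]
      have : Subtype.val '' {x : PuncturedOrthant d | a ≤ x.1 i} =
          {x : Fin d → ℝ≥0∞ | a ≤ x i} := by
        ext y
        refine ⟨?_, fun hy => ⟨⟨y, ?_⟩, hy, rfl⟩⟩
        · rintro ⟨x, hx, rfl⟩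
          exact hx
        · rintro rfl
          exact ha (le_zero_iff.1 hy)
      rw [this]
      exact (isClosed_le continuous_const (continuous_apply i)).isCompact
    · have : φ (x.1 i) = 0 := hφa _ (not_le.1 hx).le
      simp [hf, this]
  have hlim := hν.tendsto f hfc hfs
  rw [integral_eq_zero_of_ae h] at hlim
  refine squeeze_zero (fun n => by positivity) (fun n => ?_) hlim
  have hemb : MeasurableEmbedding (Subtype.val : PuncturedOrthant d → Fin d → ℝ≥0∞) :=
    MeasurableEmbedding.subtype_coe (measurableSet_singleton 0).compl
  have hmeas : Measurable fun ω (j : Fin d) => ENNReal.ofReal (V j ω / b n) :=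
    measurable_pi_lambda _ fun j => ((hV j).div_const _).ennreal_ofReal
  have : IsProbabilityMeasure (P.map fun ω (j : Fin d) => ENNReal.ofReal (V j ω / b n)) :=
    Measure.isProbabilityMeasure_map hmeas.aemeasurable
  have hfin : IsFiniteMeasure (scaledLaw P V (b n)) := by
    refine ⟨?_⟩
    rw [scaledLaw, hemb.comap_apply]
    exact measure_lt_top _ _
  have hmarkov := mul_meas_ge_le_integral_of_nonneg (μ := scaledLaw P V (b n))
    (ae_of_all _ hf0) (hfc.integrable_of_hasCompactSupport hfs) 1
  have himage : Subtype.val '' {x : PuncturedOrthant d | 1 ≤ f x} =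
      {y : Fin d → ℝ≥0∞ | 1 ≤ φ (y i) * ψ (y j)} := by
    ext y
    refine ⟨?_, fun hy => ⟨⟨y, ?_⟩, hy, rfl⟩⟩
    · rintro ⟨x, hx, rfl⟩
      exact hx
    · rintro rfl
      have : φ 0 = 0 := hφa 0 zero_le
      simp only [Set.mem_ofPred_eq, Pi.zero_apply, this, zero_mul] at hy
      exact absurd hy (by norm_num)
  have hset : MeasurableSet {y : Fin d → ℝ≥0∞ | 1 ≤ φ (y i) * ψ (y j)} :=
    (isClosed_le continuous_const (by fun_prop)).measurableSet
  rw [one_mul, measureReal_def, scaledLaw, hemb.comap_apply, himage, ← measureReal_def,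
    map_measureReal_apply hmeas hset] at hmarkov
  rw [integral_smul_measure, ENNReal.toReal_natCast, smul_eq_mul]
  exact mul_le_mul_of_nonneg_left hmarkov n.cast_nonneg

/-- Passage from the discrete scale `n ^ (1 / α)` to the continuous scale `t`. -/
lemma tendsto_rpow_mul_of_floor (hα : 0 < α) {E : ℝ → Set Ω} {F : ℕ → Set Ω}
    (hF : Tendsto (fun n : ℕ => (n : ℝ) * P.real (F n)) atTop (𝓝 0))
    (hEF : ∀ᶠ t in atTop, E t ⊆ F ⌊t ^ α⌋₊) :
    Tendsto (fun t : ℝ => t ^ α * P.real (E t)) atTop (𝓝 0) := by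
  have hpow : Tendsto (fun t : ℝ => t ^ α) atTop atTop := tendsto_rpow_atTop hα
  have h2 := ((hF.comp tendsto_nat_floor_atTop).comp hpow).const_mul 2
  rw [mul_zero] at h2
  refine squeeze_zero' ?_ ?_ h2
  · filter_upwards [eventually_ge_atTop 0] with t ht
    positivity
  · filter_upwards [hEF, hpow.eventually_ge_atTop 1] with t ht ht1
    have h3 : (1 : ℝ) ≤ ⌊t ^ α⌋₊ := by exact_mod_cast Nat.le_floor (by simpa using ht1)
    have h4 := Nat.lt_floor_add_one (t ^ α)
    calc t ^ α * P.real (E t) ≤ (2 * ⌊t ^ α⌋₊) * P.real (F ⌊t ^ α⌋₊) := by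
          exact mul_le_mul (by linarith) (measureReal_mono ht) measureReal_nonneg (by positivity)
      _ = _ := by simp [mul_assoc]

lemma floor_rpow_le {t : ℝ} (hα : 0 < α) (ht : 0 ≤ t) :
    ((⌊t ^ α⌋₊ : ℕ) : ℝ) ^ (1 / α) ≤ t := by
  calc ((⌊t ^ α⌋₊ : ℕ) : ℝ) ^ (1 / α) ≤ (t ^ α) ^ (1 / α) := by
        gcongr
        exact Nat.floor_le (by positivity)
    _ = t := by rw [one_div, Real.rpow_rpow_inv ht hα.ne']

lemma tendsto_floor_rpow_div (hα : 0 < α) :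
    Tendsto (fun t : ℝ => ((⌊t ^ α⌋₊ : ℕ) : ℝ) ^ (1 / α) / t) atTop (𝓝 1) := by
  have h1 := ((tendsto_nat_floor_div_atTop (R := ℝ)).comp (tendsto_rpow_atTop hα)).rpow_const
    (p := 1 / α) (Or.inl one_ne_zero)
  rw [Real.one_rpow] at h1
  refine h1.congr' ?_
  filter_upwards [eventually_gt_atTop 0] with t ht
  simp only [Function.comp_apply]
  rw [Real.div_rpow (by positivity) (by positivity), one_div, Real.rpow_rpow_inv ht.le hα.ne']

/-- A continuous function on `[0,∞]` with values in `[0,1]` that climbs from `0` to `1` between `a`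
and `b`. -/
lemma exists_ramp {a b : ℝ≥0∞} (hab : a < b) : ∃ φ : ℝ≥0∞ → ℝ, Continuous φ ∧
    (∀ x ≤ a, φ x = 0) ∧ (∀ x, b ≤ x → φ x = 1) ∧ ∀ x, 0 ≤ φ x ∧ φ x ≤ 1 := by
  obtain ⟨f, h0, h1, h01⟩ := exists_continuous_zero_one_of_isClosed (isClosed_Iic (a := a))
    (isClosed_Ici (a := b)) (Set.Iic_disjoint_Ici.2 (not_le.2 hab))
  exact ⟨f, f.continuous, fun x hx => h0 hx, fun x hx => h1 hx, h01⟩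

/-- Under asymptotic independence two components are unlikely to be large together. -/
theorem tendsto_joint_tail_of_axes (hα : 0 < α) {ν : Measure (PuncturedOrthant d)}
    (hν : IsExponentMeasure P V (fun n => (n : ℝ) ^ (1 / α)) ν) (hax : ν (axes d)ᶜ = 0)
    (hV : ∀ j, Measurable (V j)) {i j : Fin d} (hij : i ≠ j) {ε : ℝ} (hε : 0 < ε) :
    Tendsto (fun t : ℝ => t ^ α * P.real {ω | ε * t ≤ V i ω ∧ ε * t ≤ V j ω}) atTop (𝓝 0) := by
  obtain ⟨φ, hφc, hφ0, hφ1, hφI⟩ := exists_ramp (a := ENNReal.ofReal (ε / 2))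
    (b := ENNReal.ofReal ε) ((ENNReal.ofReal_lt_ofReal_iff hε).2 (by linarith))
  have hae : ∀ᵐ x ∂ν, φ (x.1 i) * φ (x.1 j) = 0 := by
    have hx : ∀ᵐ x ∂ν, x ∈ axes d := hax
    filter_upwards [hx] with x ⟨k, hk⟩
    by_cases hik : i = k
    · rw [hk j (fun h => hij (hik.trans h.symm)), hφ0 0 zero_le, mul_zero]
    · rw [hk i hik, hφ0 0 zero_le, zero_mul]
  have hlim := tendsto_mul_measureReal_testFunction hν hV hφc hφc (fun x => (hφI x).1)
    (fun x => (hφI x).1) (by simpa using hε) hφ0 i j hae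
  refine tendsto_rpow_mul_of_floor hα hlim ?_
  filter_upwards [eventually_gt_atTop 0,
    (tendsto_floor_rpow_div hα).eventually (lt_mem_nhds one_pos)] with t ht hb ω ⟨hi, hj⟩
  have hb' : 0 < ((⌊t ^ α⌋₊ : ℕ) : ℝ) ^ (1 / α) := by
    simpa [ht] using (div_pos_iff_of_pos_right ht).1 hb
  have hle := floor_rpow_le hα ht.le
  have key : ∀ v, ε * t ≤ v →
      φ (ENNReal.ofReal (v / ((⌊t ^ α⌋₊ : ℕ) : ℝ) ^ (1 / α))) = 1 := by
    intro v hv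
    refine hφ1 _ (ENNReal.ofReal_le_ofReal ?_)
    rw [le_div_iff₀ hb']
    exact (mul_le_mul_of_nonneg_left hle hε.le).trans hv
  change 1 ≤ φ _ * φ _
  rw [key _ hi, key _ hj, one_mul]

/-- Under asymptotic full dependence the components, divided by `K j ^ (1 / α)`, are unlikely to
be of the order `t` and in a ratio different from `1`. -/
theorem tendsto_discrepancy_of_dependenceLine (hα : 0 < α) {K : Fin d → ℝ} (hK : ∀ j, 0 < K j)
    {ν : Measure (PuncturedOrthant d)}
    (hν : IsExponentMeasure P V (fun n => (n : ℝ) ^ (1 / α)) ν)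
    (hline : ν (dependenceLine α K)ᶜ = 0)
    (hV : ∀ j, Measurable (V j)) (i j : Fin d) {δ : ℝ} (hδ : 0 < δ) (hδ1 : δ < 1) :
    Tendsto (fun t : ℝ => t ^ α * P.real {ω | K i ^ (1 / α) * t ≤ V i ω ∧
      V j ω ≤ K j ^ (1 / α) * ((1 - δ) * t)}) atTop (𝓝 0) := by
  have hki : 0 < K i ^ (1 / α) := Real.rpow_pos_of_pos (hK i) _
  have hkj : 0 < K j ^ (1 / α) := Real.rpow_pos_of_pos (hK j) _
  set ki := K i ^ (1 / α)
  set kj := K j ^ (1 / α)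
  obtain ⟨φ, hφc, hφ0, hφ1, hφI⟩ := exists_ramp (a := ENNReal.ofReal ((1 - δ / 3) * ki))
    (b := ENNReal.ofReal ki) ((ENNReal.ofReal_lt_ofReal_iff hki).2 (by nlinarith))
  obtain ⟨ψ, hψc, hψ0, hψ1, hψI⟩ := exists_ramp (a := ENNReal.ofReal ((1 - 2 * δ / 3) * kj))
    (b := ENNReal.ofReal ((1 - δ / 3) * kj))
    ((ENNReal.ofReal_lt_ofReal_iff (mul_pos (by linarith) hkj)).2 (by nlinarith))
  have hae : ∀ᵐ x ∂ν, φ (x.1 i) * (1 - ψ (x.1 j)) = 0 := by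
    have hx : ∀ᵐ x ∂ν, x ∈ dependenceLine α K := hline
    filter_upwards [hx] with x ⟨s, hs, hxs⟩
    rcases le_total s (1 - δ / 3) with h | h
    · rw [hφ0 _ (by rw [hxs]; exact ENNReal.ofReal_le_ofReal (by gcongr)), zero_mul]
    · rw [hψ1 _ (by rw [hxs]; exact ENNReal.ofReal_le_ofReal (by gcongr)), sub_self, mul_zero]
  have hlim := tendsto_mul_measureReal_testFunction hν hV (ψ := fun x => 1 - ψ x) hφc
    (continuous_const.sub hψc) (fun x => (hφI x).1) (fun x => by linarith [(hψI x).2])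
    (by simpa using mul_pos (by linarith : 0 < 1 - δ / 3) hki) hφ0 i j hae
  refine tendsto_rpow_mul_of_floor hα hlim ?_
  have hratio : (1 - δ) / (1 - 2 * δ / 3) < 1 := by
    rw [div_lt_one (by linarith)]
    linarith
  filter_upwards [eventually_gt_atTop 0,
    (tendsto_floor_rpow_div hα).eventually (lt_mem_nhds hratio)] with t ht hb ω ⟨hi, hj⟩
  have h23 : 0 < 1 - 2 * δ / 3 := by linarith
  rw [div_lt_div_iff₀ h23 ht] at hb
  have hle := floor_rpow_le hα ht.le
  set B := ((⌊t ^ α⌋₊ : ℕ) : ℝ) ^ (1 / α)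
  have hB : 0 < B := by
    have : 0 < (1 - δ) * t := mul_pos (by linarith) ht
    exact pos_of_mul_pos_left (this.trans hb) h23.le
  have h1 : φ (ENNReal.ofReal (V i ω / B)) = 1 := by
    refine hφ1 _ (ENNReal.ofReal_le_ofReal ?_)
    rw [le_div_iff₀ hB]
    exact (mul_le_mul_of_nonneg_left hle hki.le).trans hi
  have h2 : ψ (ENNReal.ofReal (V j ω / B)) = 0 := by
    refine hψ0 _ (ENNReal.ofReal_le_ofReal ?_)
    rw [div_le_iff₀ hB]
    calc V j ω ≤ kj * ((1 - δ) * t) := hj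
      _ ≤ kj * (B * (1 - 2 * δ / 3)) := by gcongr
      _ = _ := by ring
  change 1 ≤ φ _ * (1 - ψ _)
  rw [h1, h2, sub_zero, one_mul]

end Tails

section LinearCombinations

variable {Ω : Type*} [MeasurableSpace Ω] {P : Measure Ω} [IsProbabilityMeasure P] {α : ℝ} {d : ℕ}

/-! ### Sums with a single large term -/

/-- A sum of nonnegative terms that reaches `t` has a term of size at least `(1 - δ) * t`, or two
terms of size at least `δ / (d + 1) * t`. -/
lemma exists_large_of_le_sum {y : Fin d → ℝ} {δ t : ℝ} (hδ : 0 < δ) (hδ1 : δ < 1) (ht : 0 < t)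
    (h : t ≤ ∑ j, y j) : (∃ j, (1 - δ) * t ≤ y j) ∨
      ∃ i j, i ≠ j ∧ δ / (d + 1) * t ≤ y i ∧ δ / (d + 1) * t ≤ y j := by
  by_contra! hcon
  obtain ⟨h1, h2⟩ := hcon
  have hη : (d : ℝ) * (δ / (d + 1) * t) < δ * t := by
    have hd : (0 : ℝ) < d + 1 := by positivity
    rw [div_mul_eq_mul_div, mul_div_assoc', div_lt_iff₀ hd]
    nlinarith [mul_pos hδ ht]
  set η := δ / (d + 1) * t
  have hη0 : 0 ≤ η := by positivity
  have h1δ : 0 ≤ (1 - δ) * t := mul_nonneg (by linarith) ht.le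
  have hsum : ∑ j, y j ≤ d * η + (1 - δ) * t := by
    by_cases hm : ∃ m, η ≤ y m
    · obtain ⟨m, hm⟩ := hm
      calc ∑ j, y j ≤ ∑ j, (η + if j = m then (1 - δ) * t else 0) := by
            refine Finset.sum_le_sum fun j _ => ?_
            by_cases hj : j = m
            · rw [if_pos hj]
              linarith [h1 j]
            · rw [if_neg hj]
              linarith [h2 m j (Ne.symm hj) hm]
        _ = _ := by simp [Finset.sum_add_distrib]
    · push Not at hm
      calc ∑ j, y j ≤ ∑ _j : Fin d, η := Finset.sum_le_sum fun j _ => (hm j).le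
        _ ≤ _ := by simpa using h1δ
  linarith

/-- Bonferroni's lower bound for the probability of a union. -/
lemma sum_measureReal_le_add_pairs {A : Fin d → Set Ω} (hA : ∀ j, MeasurableSet (A j)) :
    ∑ j, P.real (A j) ≤ P.real (⋃ j, A j) + ∑ j, ∑ i, P.real {ω | i ≠ j ∧ ω ∈ A i ∧ ω ∈ A j} := by
  set B : Fin d → Set Ω := fun j => A j \ ⋃ i, ⋃ _ : i ≠ j, A i with hB
  have hBm : ∀ j, MeasurableSet (B j) := fun j =>
    (hA j).diff (MeasurableSet.iUnion fun i => MeasurableSet.iUnion fun _ => hA i)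
  have hdisj : Pairwise (Function.onFun Disjoint B) := by
    intro i j hij
    refine Set.disjoint_left.2 fun ω hi hj => hj.2 ?_
    exact Set.mem_iUnion₂.2 ⟨i, hij, hi.1⟩
  have hunion : ∑ j, P.real (B j) ≤ P.real (⋃ j, A j) := by
    rw [← measureReal_iUnion_fintype hdisj hBm]
    exact measureReal_mono (Set.iUnion_mono fun j => Set.sdiff_subset)
  have hj : ∀ j, P.real (A j) ≤
      P.real (B j) + ∑ i, P.real {ω | i ≠ j ∧ ω ∈ A i ∧ ω ∈ A j} := by
    intro j
    calc P.real (A j) ≤ P.real (B j ∪ ⋃ i, {ω | i ≠ j ∧ ω ∈ A i ∧ ω ∈ A j}) := by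
          refine measureReal_mono fun ω hω => ?_
          by_cases h : ω ∈ ⋃ i, ⋃ _ : i ≠ j, A i
          · obtain ⟨i, hij, hi⟩ := Set.mem_iUnion₂.1 h
            exact Or.inr (Set.mem_iUnion.2 ⟨i, hij, hi, hω⟩)
          · exact Or.inl ⟨hω, h⟩
      _ ≤ _ := (measureReal_union_le _ _).trans
          (add_le_add_right (measureReal_iUnion_fintype_le _) _)
  calc ∑ j, P.real (A j) ≤ _ := Finset.sum_le_sum fun j _ => hj j
    _ ≤ _ := by rw [Finset.sum_add_distrib]; gcongr

/-- Principle of a single big jump: if no two terms are large together, the tail of the sum is the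
sum of the tails. -/
theorem tendsto_tail_sum_of_pairwise {Y : Fin d → Ω → ℝ} (hY : ∀ j, Measurable (Y j))
    (hY0 : ∀ j, ∀ᵐ ω ∂P, 0 ≤ Y j ω) {c : Fin d → ℝ}
    (htail : ∀ j u, 0 < u →
      Tendsto (fun t : ℝ => t ^ α * P.real {ω | u * t ≤ Y j ω}) atTop (𝓝 (c j * u ^ (-α))))
    (hjoint : ∀ i j, i ≠ j → ∀ u, 0 < u →
      Tendsto (fun t : ℝ => t ^ α * P.real {ω | u * t ≤ Y i ω ∧ u * t ≤ Y j ω}) atTop (𝓝 0)) :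
    Tendsto (fun t : ℝ => t ^ α * P.real {ω | t ≤ ∑ j, Y j ω}) atTop (𝓝 (∑ j, c j)) := by
  set R : ℝ → ℝ → ℝ := fun u t =>
    ∑ j, ∑ i, P.real {ω | i ≠ j ∧ u * t ≤ Y i ω ∧ u * t ≤ Y j ω} with hR
  have hRlim : ∀ u, 0 < u → Tendsto (fun t => t ^ α * R u t) atTop (𝓝 0) := by
    intro u hu
    have : Tendsto (fun t : ℝ => ∑ j, ∑ i, t ^ α *
        P.real {ω | i ≠ j ∧ u * t ≤ Y i ω ∧ u * t ≤ Y j ω}) atTop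
        (𝓝 (∑ _j : Fin d, ∑ _i : Fin d, 0)) := by
      refine tendsto_finsetSum _ fun j _ => tendsto_finsetSum _ fun i _ => ?_
      by_cases hij : i = j
      · simp [hij]
      · simpa [hij] using hjoint i j hij u hu
    simpa [hR, Finset.mul_sum] using this
  have hTlim : ∀ u, 0 < u → Tendsto (fun t => t ^ α * ∑ j, P.real {ω | u * t ≤ Y j ω}) atTop
      (𝓝 ((∑ j, c j) * u ^ (-α))) := by
    intro u hu
    simp_rw [Finset.mul_sum, Finset.sum_mul]
    exact tendsto_finsetSum _ fun j _ => htail j u hu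
  refine tendsto_of_parametric_bounds
    (fun _ t => t ^ α * ∑ j, P.real {ω | 1 * t ≤ Y j ω} - t ^ α * R 1 t)
    (fun δ t => t ^ α * ∑ j, P.real {ω | (1 - δ) * t ≤ Y j ω} + t ^ α * R (δ / (d + 1)) t)
    (L := fun _ => ∑ j, c j) (U := fun δ => (∑ j, c j) * (1 - δ) ^ (-α)) tendsto_const_nhds
    (tendsto_const_mul_one_sub_rpow _ _) fun δ hδ => ⟨?_, ?_, ?_⟩
  · filter_upwards [eventually_gt_atTop 0] with t ht
    have htα : 0 ≤ t ^ α := by positivity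
    rw [← mul_sub, ← mul_add]
    refine ⟨mul_le_mul_of_nonneg_left ?_ htα, mul_le_mul_of_nonneg_left ?_ htα⟩
    · have hB := sum_measureReal_le_add_pairs (P := P) (A := fun j => {ω | 1 * t ≤ Y j ω})
        fun j => measurableSet_le measurable_const (hY j)
      have hsub : P.real (⋃ j, {ω | 1 * t ≤ Y j ω}) ≤ P.real {ω | t ≤ ∑ j, Y j ω} := by
        refine ENNReal.toReal_mono (measure_ne_top _ _) (measure_mono_ae ?_)
        filter_upwards [ae_all_iff.2 hY0] with ω h0 hω
        obtain ⟨j, hj⟩ := Set.mem_iUnion.1 hω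
        change 1 * t ≤ Y j ω at hj
        rw [one_mul] at hj
        exact hj.trans (Finset.single_le_sum (f := fun j => Y j ω) (fun i _ => h0 i)
          (Finset.mem_univ j))
      have hB' : ∑ j, P.real {ω | 1 * t ≤ Y j ω} ≤
          P.real (⋃ j, {ω | 1 * t ≤ Y j ω}) + R 1 t := hB
      linarith
    · have hsub : {ω | t ≤ ∑ j, Y j ω} ⊆ (⋃ j, {ω | (1 - δ) * t ≤ Y j ω}) ∪
          ⋃ j, ⋃ i, {ω | i ≠ j ∧ δ / (d + 1) * t ≤ Y i ω ∧ δ / (d + 1) * t ≤ Y j ω} := by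
        intro ω hω
        rcases exists_large_of_le_sum hδ.1 hδ.2 ht hω with ⟨j, hj⟩ | ⟨i, j, hij, hi, hj⟩
        · exact Or.inl (Set.mem_iUnion.2 ⟨j, hj⟩)
        · exact Or.inr (Set.mem_iUnion₂.2 ⟨j, i, hij, hi, hj⟩)
      refine (measureReal_mono hsub).trans ((measureReal_union_le _ _).trans (add_le_add
        (measureReal_iUnion_fintype_le _) ((measureReal_iUnion_fintype_le _).trans ?_)))
      exact Finset.sum_le_sum fun j _ => measureReal_iUnion_fintype_le _
  · simpa using (hTlim 1 one_pos).sub (hRlim 1 one_pos)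
  · have hd : 0 < δ / (d + 1) := div_pos hδ.1 (by positivity)
    simpa using (hTlim (1 - δ) (by linarith [hδ.2])).add (hRlim _ hd)

/-! ### Tails of linear combinations with fixed coefficients -/

variable {V : Fin d → Ω → ℝ} {K : Fin d → ℝ}

theorem tendsto_tail_sum_of_asymptoticallyIndependent (hα : 0 < α) (hK : ∀ j, 0 < K j)
    (hV : ∀ j, Measurable (V j)) (hV0 : ∀ j, ∀ᵐ ω ∂P, 0 ≤ V j ω)
    (hVp : ∀ j, (fun t : ℝ => P.real {ω | t < V j ω}) ~[atTop] fun t => K j * t ^ (-α))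
    (h : AsymptoticallyIndependent P V α) {x : Fin d → ℝ} (hx : ∀ j, 0 ≤ x j) :
    Tendsto (fun t : ℝ => t ^ α * P.real {ω | t ≤ ∑ j, x j * V j ω}) atTop
      (𝓝 (∑ j, K j * x j ^ α)) := by
  obtain ⟨ν, hν, hax⟩ := h
  refine tendsto_tail_sum_of_pairwise (Y := fun j ω => x j * V j ω)
    (fun j => (hV j).const_mul _) (fun j => ?_)
    (fun j u hu => tendsto_tail_mul hα (hK j) (hVp j) (hx j) hu) fun i j hij u hu => ?_
  · filter_upwards [hV0 j] with ω hω using mul_nonneg (hx j) hω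
  · have hs : 0 < x i + x j + 1 := by linarith [hx i, hx j]
    refine squeeze_zero' ?_ ?_
      (tendsto_joint_tail_of_axes hα hν hax hV hij (div_pos hu hs))
    · filter_upwards [eventually_ge_atTop 0] with t ht
      positivity
    · filter_upwards [eventually_ge_atTop 0] with t ht
      refine mul_le_mul_of_nonneg_left ?_ (by positivity)
      refine ENNReal.toReal_mono (measure_ne_top _ _) (measure_mono_ae ?_)
      filter_upwards [hV0 i, hV0 j] with ω hi hj ⟨h1, h2⟩
      change u / _ * t ≤ V i ω ∧ u / _ * t ≤ V j ω
      rw [div_mul_eq_mul_div, div_le_iff₀ hs, div_le_iff₀ hs]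
      exact ⟨by nlinarith [mul_nonneg (hx j) hi], by nlinarith [mul_nonneg (hx i) hj]⟩

/-- With `c = ∑ j, K j ^ (1 / α) * x j`, the sum exceeds `t` essentially when one fixed component
`V i` exceeds `K i ^ (1 / α) * (t / c)`: otherwise some other component is on the opposite side of
its own threshold, a discrepancy of negligible probability. -/
theorem tendsto_tail_sum_of_asymptoticallyFullyDependent (hα : 0 < α) (hK : ∀ j, 0 < K j)
    (hV : ∀ j, Measurable (V j))
    (hVp : ∀ j, (fun t : ℝ => P.real {ω | t < V j ω}) ~[atTop] fun t => K j * t ^ (-α))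
    (h : AsymptoticallyFullyDependent P V α K) {x : Fin d → ℝ} (hx : ∀ j, 0 ≤ x j) :
    Tendsto (fun t : ℝ => t ^ α * P.real {ω | t ≤ ∑ j, x j * V j ω}) atTop
      (𝓝 ((∑ j, K j ^ (1 / α) * x j) ^ α)) := by
  obtain ⟨ν, hν, hline⟩ := h
  have hk : ∀ j, 0 < K j ^ (1 / α) := fun j => Real.rpow_pos_of_pos (hK j) _
  by_cases hx0 : ∀ j, x j = 0
  · simp only [hx0, zero_mul, mul_zero, Finset.sum_const_zero, Real.zero_rpow hα.ne']
    refine tendsto_const_nhds.congr' ?_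
    filter_upwards [eventually_gt_atTop 0] with t ht
    simp [not_le.2 ht]
  push Not at hx0
  obtain ⟨i, hi⟩ := hx0
  have hxi : 0 < x i := lt_of_le_of_ne (hx i) hi.symm
  set c : ℝ := ∑ j, K j ^ (1 / α) * x j with hc
  have hcpos : 0 < c := Finset.sum_pos' (fun j _ => mul_nonneg (hk j).le (hx j))
    ⟨i, Finset.mem_univ i, mul_pos (hk i) hxi⟩
  -- the tail of `V i` at the levels `K i ^ (1 / α) * (u * t)`
  have htail : ∀ u, 0 < u → Tendsto (fun t : ℝ => t ^ α *
      P.real {ω | K i ^ (1 / α) * (u * t) ≤ V i ω}) atTop (𝓝 (u ^ (-α))) := by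
    intro u hu
    have := tendsto_tail_mul hα (hK i) (hVp i) zero_le_one (mul_pos (hk i) hu)
    simp only [one_mul, mul_assoc, Real.one_rpow] at this
    convert! this using 2
    rw [Real.mul_rpow (hk i).le hu.le, ← Real.rpow_mul (hK i).le,
      show 1 / α * -α = -1 by field_simp, Real.rpow_neg_one, mul_inv_cancel_left₀ (hK i).ne']
  have hdisc : ∀ (a b : Fin d) (u δ : ℝ), 0 < u → 0 < δ → δ < 1 →
      Tendsto (fun t : ℝ => t ^ α * P.real {ω | K a ^ (1 / α) * (u * t) ≤ V a ω ∧
        V b ω ≤ K b ^ (1 / α) * ((1 - δ) * (u * t))}) atTop (𝓝 0) := by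
    intro a b u δ hu hδ hδ1
    have := tendsto_rpow_mul_comp_mul (f := fun t => P.real {ω | K a ^ (1 / α) * t ≤ V a ω ∧
        V b ω ≤ K b ^ (1 / α) * ((1 - δ) * t)}) hu
      (tendsto_discrepancy_of_dependenceLine hα hK hν hline hV a b hδ hδ1)
    simpa using this
  have hci : 0 < c⁻¹ := inv_pos.2 hcpos
  have hcα : c⁻¹ ^ (-α) = c ^ α := by rw [Real.inv_rpow hcpos.le, Real.rpow_neg hcpos.le, inv_inv]
  refine tendsto_of_parametric_bounds
    (fun δ t => t ^ α * P.real {ω | K i ^ (1 / α) * ((1 - δ)⁻¹ * c⁻¹ * t) ≤ V i ω} -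
      ∑ j, t ^ α * P.real {ω | K i ^ (1 / α) * ((1 - δ)⁻¹ * c⁻¹ * t) ≤ V i ω ∧
        V j ω ≤ K j ^ (1 / α) * ((1 - δ) * ((1 - δ)⁻¹ * c⁻¹ * t))})
    (fun δ t => t ^ α * P.real {ω | K i ^ (1 / α) * ((1 - δ) * c⁻¹ * t) ≤ V i ω} +
      ∑ j, t ^ α * P.real {ω | K j ^ (1 / α) * (c⁻¹ * t) ≤ V j ω ∧
        V i ω ≤ K i ^ (1 / α) * ((1 - δ) * (c⁻¹ * t))})
    (tendsto_const_mul_one_sub_rpow (c ^ α) α) (tendsto_const_mul_one_sub_rpow (c ^ α) (-α))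
    fun δ hδ => ?_
  have h1δ : 0 < 1 - δ := by linarith [hδ.2]
  have h1δi : 0 < (1 - δ)⁻¹ := inv_pos.2 h1δ
  refine ⟨?_, ?_, ?_⟩
  · filter_upwards [eventually_gt_atTop 0] with t ht
    have htα : 0 ≤ t ^ α := by positivity
    have hct : ∑ j, x j * (K j ^ (1 / α) * (c⁻¹ * t)) = t := by
      calc ∑ j, x j * (K j ^ (1 / α) * (c⁻¹ * t)) = c * (c⁻¹ * t) := by
            rw [hc, Finset.sum_mul]
            exact Finset.sum_congr rfl fun j _ => by ring
        _ = t := mul_inv_cancel_left₀ hcpos.ne' t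
    rw [← Finset.mul_sum, ← Finset.mul_sum, ← mul_sub, ← mul_add]
    refine ⟨mul_le_mul_of_nonneg_left ?_ htα, mul_le_mul_of_nonneg_left ?_ htα⟩
    · rw [sub_le_iff_le_add]
      refine (measureReal_mono (s₂ := {ω | t ≤ ∑ j, x j * V j ω} ∪
        ⋃ j, {ω | K i ^ (1 / α) * ((1 - δ)⁻¹ * c⁻¹ * t) ≤ V i ω ∧
          V j ω ≤ K j ^ (1 / α) * ((1 - δ) * ((1 - δ)⁻¹ * c⁻¹ * t))}) ?_).trans
        ((measureReal_union_le _ _).trans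
          (add_le_add_right (measureReal_iUnion_fintype_le _) _))
      intro ω hω
      by_cases hall : ∃ j, V j ω ≤ K j ^ (1 / α) * (c⁻¹ * t)
      · obtain ⟨j, hj⟩ := hall
        refine Or.inr (Set.mem_iUnion.2 ⟨j, hω, ?_⟩)
        rwa [mul_assoc _ c⁻¹ t, mul_inv_cancel_left₀ h1δ.ne']
      · push Not at hall
        refine Or.inl ?_
        change t ≤ ∑ j, x j * V j ω
        calc t = ∑ j, x j * (K j ^ (1 / α) * (c⁻¹ * t)) := hct.symm
          _ ≤ _ := Finset.sum_le_sum fun j _ => mul_le_mul_of_nonneg_left (hall j).le (hx j)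
    · refine (measureReal_mono (s₂ := {ω | K i ^ (1 / α) * ((1 - δ) * c⁻¹ * t) ≤ V i ω} ∪
        ⋃ j, {ω | K j ^ (1 / α) * (c⁻¹ * t) ≤ V j ω ∧
          V i ω ≤ K i ^ (1 / α) * ((1 - δ) * (c⁻¹ * t))}) ?_).trans
        ((measureReal_union_le _ _).trans
          (add_le_add_right (measureReal_iUnion_fintype_le _) _))
      intro ω (hω : t ≤ ∑ j, x j * V j ω)
      obtain ⟨j, hj⟩ : ∃ j, K j ^ (1 / α) * (c⁻¹ * t) ≤ V j ω := by
        by_contra! hcon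
        have : ∑ j, x j * V j ω < ∑ j, x j * (K j ^ (1 / α) * (c⁻¹ * t)) :=
          Finset.sum_lt_sum (fun j _ => mul_le_mul_of_nonneg_left (hcon j).le (hx j))
            ⟨i, Finset.mem_univ i, mul_lt_mul_of_pos_left (hcon i) hxi⟩
        linarith
      rcases le_total (K i ^ (1 / α) * ((1 - δ) * c⁻¹ * t)) (V i ω) with h | h
      · exact Or.inl h
      · refine Or.inr (Set.mem_iUnion.2 ⟨j, hj, ?_⟩)
        rwa [mul_assoc _ c⁻¹ t] at h
  · have h1 := (htail _ (mul_pos h1δi hci)).sub (tendsto_finsetSum Finset.univ fun j _ =>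
      hdisc i j _ δ (mul_pos h1δi hci) hδ.1 hδ.2)
    simp only [Finset.sum_const_zero, sub_zero] at h1
    convert! h1 using 2
    rw [Real.mul_rpow h1δi.le hci.le, hcα, Real.inv_rpow h1δ.le, Real.rpow_neg h1δ.le, inv_inv,
      mul_comm]
  · have h1 := (htail _ (mul_pos h1δ hci)).add (tendsto_finsetSum Finset.univ fun j _ =>
      hdisc j i _ δ hci hδ.1 hδ.2)
    simp only [Finset.sum_const_zero, add_zero] at h1
    convert! h1 using 2
    rw [Real.mul_rpow h1δ.le hci.le, hcα, mul_comm]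

/-! ### A uniform bound on the tails -/

lemma exists_tail_bound {W : Ω → ℝ} {κ : ℝ} (hα : 0 < α) (hκ : 0 < κ)
    (h : (fun t : ℝ => P.real {ω | t < W ω}) ~[atTop] fun t => κ * t ^ (-α)) :
    ∃ C : ℝ, ∀ x t : ℝ, 0 ≤ x → 0 < t → t ^ α * P.real {ω | t ≤ x * W ω} ≤ C * x ^ α := by
  have hlim := tendsto_tail_mul hα hκ h zero_le_one one_pos
  simp only [one_mul, Real.one_rpow, mul_one] at hlim
  obtain ⟨T, hT⟩ := eventually_atTop.1 (hlim.eventually (gt_mem_nhds (lt_add_one κ)))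
  have hC : ∀ t : ℝ, 0 < t → t ^ α * P.real {ω | t ≤ W ω} ≤ κ + 1 + (max T 0) ^ α := by
    intro t ht
    have h0 : 0 ≤ (max T 0) ^ α := Real.rpow_nonneg (le_max_right _ _) _
    rcases le_total T t with h | h
    · linarith [hT t h]
    · calc t ^ α * P.real {ω | t ≤ W ω} ≤ t ^ α * 1 := by
            gcongr
            exact measureReal_le_one
        _ ≤ (max T 0) ^ α := by
            rw [mul_one]
            gcongr
            exact h.trans (le_max_left _ _)
        _ ≤ _ := by linarith
  refine ⟨κ + 1 + (max T 0) ^ α, fun x t hx ht => ?_⟩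
  rcases hx.eq_or_lt with rfl | hx
  · simp [not_le.2 ht, Real.zero_rpow hα.ne']
  · have hset : {ω | t ≤ x * W ω} = {ω | t / x ≤ W ω} := by
      ext ω
      change t ≤ x * W ω ↔ t / x ≤ W ω
      rw [div_le_iff₀ hx, mul_comm]
    have hsplit : t ^ α = (t / x) ^ α * x ^ α := by
      rw [← Real.mul_rpow (by positivity) hx.le, div_mul_cancel₀ _ hx.ne']
    rw [hset, hsplit, mul_right_comm]
    exact mul_le_mul_of_nonneg_right (hC _ (div_pos ht hx)) (by positivity)

/-- The tail of a linear combination is dominated by a function of the coefficients: if the sum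
reaches `t`, one of its `d` terms reaches `t / d`. -/
lemma exists_tail_sum_bound (hα : 0 < α) (hK : ∀ j, 0 < K j)
    (hVp : ∀ j, (fun t : ℝ => P.real {ω | t < V j ω}) ~[atTop] fun t => K j * t ^ (-α)) :
    ∃ C : Fin d → ℝ, ∀ (x : Fin d → ℝ) (t : ℝ), (∀ j, 0 ≤ x j) → 0 < t →
      t ^ α * P.real {ω | t ≤ ∑ j, x j * V j ω} ≤ ∑ j, C j * x j ^ α := by
  choose C hC using fun j => exists_tail_bound hα (hK j) (hVp j)
  refine ⟨fun j => C j * (d : ℝ) ^ α, fun x t hx ht => ?_⟩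
  have hsub : {ω | t ≤ ∑ j, x j * V j ω} ⊆ ⋃ j, {ω | t ≤ (d * x j) * V j ω} := by
    intro ω (hω : t ≤ ∑ j, x j * V j ω)
    have hd : 0 < d := by
      rcases Nat.eq_zero_or_pos d with rfl | h
      · rw [Finset.univ_eq_empty, Finset.sum_empty] at hω
        exact absurd ht (not_lt.2 hω)
      · exact h
    have hd' : (0 : ℝ) < d := by exact_mod_cast hd
    have : Nonempty (Fin d) := ⟨⟨0, hd⟩⟩
    obtain ⟨j, -, hj⟩ := Finset.exists_le_of_sum_le (s := Finset.univ)
      (f := fun _ : Fin d => t / d) (g := fun j => x j * V j ω) Finset.univ_nonempty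
      (by simpa [mul_div_cancel₀ _ hd'.ne'] using hω)
    refine Set.mem_iUnion.2 ⟨j, ?_⟩
    change t ≤ d * x j * V j ω
    rw [div_le_iff₀ hd'] at hj
    linarith
  calc t ^ α * P.real {ω | t ≤ ∑ j, x j * V j ω}
      ≤ t ^ α * ∑ j, P.real {ω | t ≤ (d * x j) * V j ω} := by
        gcongr
        exact (measureReal_mono hsub).trans (measureReal_iUnion_fintype_le _)
    _ = ∑ j, t ^ α * P.real {ω | t ≤ (d * x j) * V j ω} := Finset.mul_sum _ _ _
    _ ≤ ∑ j, C j * (d * x j) ^ α :=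
        Finset.sum_le_sum fun j _ => hC j _ t (mul_nonneg d.cast_nonneg (hx j)) ht
    _ = _ := Finset.sum_congr rfl fun j _ => by
        rw [Real.mul_rpow d.cast_nonneg (hx j), mul_assoc]

/-! ### Random coefficients -/

lemma integrable_rpow_poissonMeasure (r : ℝ≥0) {α : ℝ} :
    Integrable (fun n : ℕ => (n : ℝ) ^ α) (poissonMeasure r) := by
  set m := ⌈α⌉₊
  rw [integrable_poissonMeasure_iff]
  -- `n ^ α ≤ 1 + m! * exp n` for `m ≥ α`
  have hbound : ∀ n : ℕ, (n : ℝ) ^ α ≤ 1 + m.factorial * Real.exp 1 ^ n := by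
    intro n
    rcases Nat.eq_zero_or_pos n with rfl | hn
    · have h1 : ((0 : ℕ) : ℝ) ^ α ≤ 1 := by
        rw [Nat.cast_zero]
        exact Real.zero_rpow_le_one α
      have h2 : (0 : ℝ) ≤ m.factorial * Real.exp 1 ^ 0 := by positivity
      linarith
    · have h1 : (n : ℝ) ^ α ≤ (n : ℝ) ^ m := by
        rw [← Real.rpow_natCast]
        exact Real.rpow_le_rpow_of_exponent_le (by exact_mod_cast hn) (Nat.le_ceil α)
      have h2 := Real.pow_div_factorial_le_exp n n.cast_nonneg m
      rw [div_le_iff₀ (by positivity)] at h2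
      rw [← Real.exp_nat_mul, mul_one]
      linarith
  have hsum : Summable fun n : ℕ => Real.exp (-r) * ((r : ℝ) ^ n / n.factorial) +
      Real.exp (-r) * m.factorial * ((r * Real.exp 1) ^ n / n.factorial) :=
    ((Real.summable_pow_div_factorial r).mul_left _).add
      ((Real.summable_pow_div_factorial _).mul_left _)
  refine hsum.of_nonneg_of_le (fun n => by positivity) fun n => ?_
  rw [Real.norm_of_nonneg (by positivity)]
  calc Real.exp (-r) * r ^ n / n.factorial * (n : ℝ) ^ α
      ≤ Real.exp (-r) * r ^ n / n.factorial * (1 + m.factorial * Real.exp 1 ^ n) := by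
        gcongr
        exact hbound n
    _ = _ := by
        rw [mul_pow]
        ring

/-- Breiman-type theorem: if each linear combination with fixed coefficients `x` has the tail
`c x * t ^ (-α)`, then the combination with independent random coefficients `X` has the tail
`E (c X) * t ^ (-α)`. Conditioning on `X`, this is dominated convergence. -/
theorem tail_randomCoefficients (hα : 0 < α) (hK : ∀ j, 0 < K j)
    (hV : ∀ j, Measurable (V j))
    (hVp : ∀ j, (fun t : ℝ => P.real {ω | t < V j ω}) ~[atTop] fun t => K j * t ^ (-α))
    {X : Fin d → Ω → ℕ} (hX : ∀ j, Measurable (X j))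
    (hXint : ∀ j, Integrable (fun ω => (X j ω : ℝ) ^ α) P)
    (hXV : IndepFun (fun ω j => X j ω) (fun ω j => V j ω) P)
    {c : (Fin d → ℕ) → ℝ} (hc0 : ∀ x, 0 ≤ c x) (hcz : ∀ x, c x = 0 → ∀ j, x j = 0)
    (hlim : ∀ x : Fin d → ℕ, Tendsto (fun t : ℝ =>
      t ^ α * P.real {ω | t ≤ ∑ j, (x j : ℝ) * V j ω}) atTop (𝓝 (c x))) :
    Integrable (fun ω => c fun j => X j ω) P ∧
    (fun t : ℝ => P.real {ω | t ≤ ∑ j, (X j ω : ℝ) * V j ω}) ~[atTop]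
      fun t => t ^ (-α) * ∫ ω, c (fun j => X j ω) ∂P := by
  have hX' : Measurable fun ω j => X j ω := measurable_pi_lambda _ hX
  have hV' : Measurable fun ω j => V j ω := measurable_pi_lambda _ hV
  have : IsProbabilityMeasure (P.map fun ω j => V j ω) :=
    Measure.isProbabilityMeasure_map hV'.aemeasurable
  have : IsProbabilityMeasure (P.map fun ω j => X j ω) :=
    Measure.isProbabilityMeasure_map hX'.aemeasurable
  have hmeas : ∀ f : (Fin d → ℕ) → ℝ, Measurable f := fun f => Measurable.of_discrete
  obtain ⟨C, hC⟩ := exists_tail_sum_bound hα hK hVp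
  have hcond : ∀ t : ℝ, P.real {ω | t ≤ ∑ j, (X j ω : ℝ) * V j ω} =
      ∫ ω, P.real {ω' | t ≤ ∑ j, (X j ω : ℝ) * V j ω'} ∂P := by
    intro t
    rw [map_prod_measureReal_sum_mul hX hV hXV, measureReal_prod_apply _ _
      (measurableSet_sum_mul t), integral_map hX'.aemeasurable
      (hmeas _).aestronglyMeasurable]
    refine integral_congr_ae (ae_of_all _ fun ω => ?_)
    exact map_measureReal_apply hV' (measurable_prodMk_left (measurableSet_sum_mul t))
  have hbint : Integrable (fun ω => ∑ j, C j * (X j ω : ℝ) ^ α) P :=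
    integrable_finsetSum _ fun j _ => (hXint j).const_mul _
  have hcle : ∀ x : Fin d → ℕ, c x ≤ ∑ j, C j * (x j : ℝ) ^ α := by
    intro x
    refine le_of_tendsto (hlim x) ?_
    filter_upwards [eventually_gt_atTop 0] with t ht
    exact hC (fun j => x j) t (fun j => (x j).cast_nonneg) ht
  have hcint : Integrable (fun ω => c fun j => X j ω) P := by
    refine hbint.mono' ((hmeas c).comp hX').aestronglyMeasurable (ae_of_all _ fun ω => ?_)
    rw [Real.norm_of_nonneg (hc0 _)]
    exact hcle _
  refine ⟨hcint, ?_⟩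
  have hmain : Tendsto (fun t : ℝ => t ^ α * P.real {ω | t ≤ ∑ j, (X j ω : ℝ) * V j ω}) atTop
      (𝓝 (∫ ω, c (fun j => X j ω) ∂P)) := by
    simp_rw [hcond, ← integral_const_mul]
    refine tendsto_integral_filter_of_dominated_convergence
      (fun ω => ∑ j, C j * (X j ω : ℝ) ^ α) ?_ ?_ hbint (ae_of_all _ fun ω => hlim _)
    · refine Eventually.of_forall fun t => ?_
      exact ((hmeas fun x => t ^ α * P.real {ω' | t ≤ ∑ j, (x j : ℝ) * V j ω'}).comp
        hX').aestronglyMeasurable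
    · filter_upwards [eventually_gt_atTop 0] with t ht
      refine ae_of_all _ fun ω => ?_
      rw [Real.norm_of_nonneg (by positivity)]
      exact hC (fun j => X j ω) t (fun j => (X j ω).cast_nonneg) ht
  rcases (integral_nonneg fun ω => hc0 fun j => X j ω :
    0 ≤ ∫ ω, c (fun j => X j ω) ∂P).eq_or_lt with h0 | hpos
  -- if the constant vanishes then `X = 0` almost surely, and the tail is eventually zero
  · refine EventuallyEq.isEquivalent ?_
    have hae := (integral_eq_zero_iff_of_nonneg (fun ω => hc0 fun j => X j ω) hcint).1 h0.symm
    filter_upwards [eventually_gt_atTop 0] with t ht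
    rw [← h0, mul_zero, measureReal_eq_zero_iff]
    refine measure_mono_null (t := {ω | ¬ c (fun j => X j ω) = 0}) (fun ω hω hω' => ?_) hae
    have hz := hcz _ hω'
    change t ≤ ∑ j, (X j ω : ℝ) * V j ω at hω
    simp only [hz, Nat.cast_zero, zero_mul, Finset.sum_const_zero] at hω
    exact absurd ht (not_lt.2 hω)
  · have hne : ∀ᶠ t : ℝ in atTop, t ^ (-α) * ∫ ω, c (fun j => X j ω) ∂P ≠ 0 := by
      filter_upwards [eventually_gt_atTop 0] with t ht
      positivity
    rw [isEquivalent_iff_tendsto_one hne]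
    have h1 := hmain.div_const (∫ ω, c (fun j => X j ω) ∂P)
    rw [div_self hpos.ne'] at h1
    refine h1.congr' ?_
    filter_upwards [eventually_gt_atTop 0] with t ht
    have := (Real.rpow_pos_of_pos ht α).ne'
    rw [Pi.div_apply, Real.rpow_neg ht.le]
    field_simp

end LinearCombinations

end InsuranceMarket

/-! ### Losses in the random bipartite graph -/

theorem proposition4p3 {Ω : Type*} [MeasurableSpace Ω] (P : Measure Ω) [IsProbabilityMeasure P]
    (q d : ℕ)
    -- the random bipartite graph with independent edges
    (edge : Fin q → Fin d → Ω → Bool) (p : Fin q → Fin d → ℝ)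
    (hedge_meas : ∀ i j, Measurable (edge i j))
    (hedge_indep : iIndepFun (fun e : Fin q × Fin d => edge e.1 e.2) P)
    (hedge_prob : ∀ i j, P.real {ω | edge i j ω = true} = p i j)
    -- the claims: nonnegative, with Pareto tails, independent of the graph
    (V : Fin d → Ω → ℝ) (α : ℝ) (K : Fin d → ℝ) (hα : 0 < α) (hK : ∀ j, 0 < K j)
    (hV_meas : ∀ j, Measurable (V j))
    (hV_nonneg : ∀ j, ∀ᵐ ω ∂P, 0 ≤ V j ω)
    (hV_pareto : ∀ j, (fun t : ℝ => P.real {ω | t < V j ω}) ~[atTop] fun t => K j * t ^ (-α))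
    (hV_graph : IndepFun (fun ω j => V j ω) (fun ω i j => edge i j ω) P)
    -- independent Poisson variables with means `π_j`, independent of the claims
    (X : Fin d → Ω → ℕ)
    (hX_meas : ∀ j, Measurable (X j))
    (hX_indep : iIndepFun X P)
    (hX_law : ∀ j, HasLaw (X j)
      (poissonMeasure (InsuranceMarket.uninsuredProb p j).toNNReal) P)
    (hX_V : IndepFun (fun ω j => X j ω) (fun ω j => V j ω) P) :
    (∀ j, P.real {ω | InsuranceMarket.deg edge j ω = 0} = InsuranceMarket.uninsuredProb p j) ∧
    (∀ t : ℝ, 0 < t →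
      |P.real {ω | t ≤ InsuranceMarket.uninsuredLoss edge V ω} -
          P.real {ω | t ≤ ∑ j, (X j ω : ℝ) * V j ω}|
        ≤ ∑ j, InsuranceMarket.uninsuredProb p j ^ 2) ∧
    (InsuranceMarket.AsymptoticallyIndependent P V α →
      (∀ j, Integrable (fun ω => (X j ω : ℝ) ^ α) P) ∧
      (fun t : ℝ => P.real {ω | t ≤ ∑ j, (X j ω : ℝ) * V j ω}) ~[atTop]
        fun t => t ^ (-α) * ∑ j, K j * ∫ ω, (X j ω : ℝ) ^ α ∂P) ∧
    (InsuranceMarket.AsymptoticallyFullyDependent P V α K →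
      Integrable (fun ω => (∑ j, K j ^ (1 / α) * (X j ω : ℝ)) ^ α) P ∧
      (fun t : ℝ => P.real {ω | t ≤ ∑ j, (X j ω : ℝ) * V j ω}) ~[atTop]
        fun t => t ^ (-α) * ∫ ω, (∑ j, K j ^ (1 / α) * (X j ω : ℝ)) ^ α ∂P) := by
  have hXint : ∀ j, Integrable (fun ω => (X j ω : ℝ) ^ α) P := by
    intro j
    have h := InsuranceMarket.integrable_rpow_poissonMeasure
      (InsuranceMarket.uninsuredProb p j).toNNReal (α := α)
    rw [← (hX_law j).map_eq] at h
    exact h.comp_measurable (hX_meas j)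
  refine ⟨InsuranceMarket.measureReal_deg_eq_zero hedge_meas hedge_indep hedge_prob,
    fun t _ => InsuranceMarket.abs_uninsuredLoss_sub_poisson_le hedge_meas hedge_indep hedge_prob
      hV_meas hV_graph hX_meas hX_indep hX_law hX_V t, fun hind => ⟨hXint, ?_⟩, fun hdep => ?_⟩
  · have hnn : ∀ (x : Fin d → ℕ) j, 0 ≤ K j * (x j : ℝ) ^ α := fun x j =>
      mul_nonneg (hK j).le (Real.rpow_nonneg (x j).cast_nonneg _)
    have h := (InsuranceMarket.tail_randomCoefficients hα hK hV_meas hV_pareto hX_meas hXint hX_V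
      (c := fun x => ∑ j, K j * (x j : ℝ) ^ α) (fun x => Finset.sum_nonneg fun j _ => hnn x j)
      (fun x hx j => by
        have h0 := (Finset.sum_eq_zero_iff_of_nonneg fun j _ => hnn x j).1 hx j (Finset.mem_univ j)
        simpa [(hK j).ne', Real.rpow_eq_zero_iff_of_nonneg, hα.ne'] using h0)
      (fun x => InsuranceMarket.tendsto_tail_sum_of_asymptoticallyIndependent hα hK hV_meas
        hV_nonneg hV_pareto hind fun j => (x j).cast_nonneg)).2
    simp_rw [integral_finsetSum _ fun j _ => (hXint j).const_mul (K j), integral_const_mul] at h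
    exact h
  · have hk : ∀ j, 0 < K j ^ (1 / α) := fun j => Real.rpow_pos_of_pos (hK j) _
    have hnn : ∀ (x : Fin d → ℕ) j, 0 ≤ K j ^ (1 / α) * (x j : ℝ) := fun x j =>
      mul_nonneg (hk j).le (x j).cast_nonneg
    exact InsuranceMarket.tail_randomCoefficients hα hK hV_meas hV_pareto hX_meas hXint hX_V
      (c := fun x => (∑ j, K j ^ (1 / α) * (x j : ℝ)) ^ α)
      (fun x => Real.rpow_nonneg (Finset.sum_nonneg fun j _ => hnn x j) _)
      (fun x hx j => by
        have h0 := (Real.rpow_eq_zero_iff_of_nonneg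
          (Finset.sum_nonneg fun j _ => hnn x j)).1 hx
        have h1 := (Finset.sum_eq_zero_iff_of_nonneg fun j _ => hnn x j).1 h0.1 j
          (Finset.mem_univ j)
        exact_mod_cast (mul_eq_zero.1 h1).resolve_left (hk j).ne')
      (fun x => InsuranceMarket.tendsto_tail_sum_of_asymptoticallyFullyDependent hα hK hV_meas
        hV_pareto hdep fun j => (x j).cast_nonneg)
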